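/- **Theorem (Solid Harmonic Translation Theory).** For $n\in\mathbb{N}=\{0,1,2,\dots\}$ let $P_n(x)=\frac{1}{2^n n!}\frac{\mathrm{d}^n}{\mathrm{d}x^n}(x^2-1)^n$, and on $[-1,1]$ let $P_n^m(x)=(-1)^m(1-x^2)^{m/2}\frac{\mathrm{d}^m}{\mathrm{d}x^m}P_n(x)$ and $P_n^{-m}=(-1)^m\frac{(n-m)!}{(n+m)!}P_n^m$ for $0\le m\le n$. For $-n\le m\le n$ let $$Y_n^m(\theta,\phi)=\sqrt{\frac{2n+1}{4\pi}\frac{(n-m)!}{(n+m)!}}\,P_n^m(\cos\theta)\,e^{\imath m\phi},$$ and write $Y_n^m(\hat{\mathbf r})=Y_n^m(\theta,\phi)$ if $\mathbf r\in\mathbb{R}^3$ has spherical coordinates $(r,\theta,\phi)$, $r=|\mathbf r|$. Let $I_n^m(\mathbf r)=Y_n^m(\hat{\mathbf r})/r^{n+1}$ $(\mathbf r\ne 0)$ and $R_n^m(\mathbf r)=r^nY_n^m(\hat{\mathbf r})$ (with $R_0^0\equiv Y_0^0$ and $R_n^m(0)=0$ for $n\ge 1$) be the irregular and regular solid harmonics.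 Fix $n\in\mathbb{N}$. For $m\in\{-n,\dots,n\}$ and $\mathbf r,\mathrm{d}\mathbf r\in\mathbb{R}^3$ with $\mathbf r\neq 0$ put $\rho=\mathrm{d}r/r$, where $\mathrm{d}r=|\mathrm{d}\mathbf r|$, and $$t_\nu=2\sqrt{\pi}\sum_{\mu=-\nu}^{\nu}\frac{(-1)^{\nu+\mu}c_{\nu\mu}}{\sqrt{2\nu+1}}R_\nu^\mu(\mathrm{d}\mathbf r)\,I_{n+\nu}^{m-\mu}(\mathbf r),\qquad c_{\nu\mu}=\left(\frac{2n+1}{2n+2\nu+1}\binom{n+m+\nu-\mu}{\nu-\mu}\binom{n-m+\nu+\mu}{\nu+\mu}\right)^{1/2}.$$ 1. If $\rho<1$, then $$I_n^m(\mathbf r+\mathrm{d}\mathbf r)=\sum_{\nu=0}^{\infty}t_\nu ,$$ the series being absolutely convergent in $\nu$. For $p\in\mathbb{N}$ and $\rho<1$ let $\epsilon_p=\left|\sum_{\nu=p+1}^{\infty}t_\nu\right|$ be the truncation error. For $0<\delta\le 1$ let $N=N_\delta^{(n)}=(n+1)/\delta$, and for a real polynomial $q$ consider the bound $$\epsilon_p<\sqrt{\frac{3\,q(2N)}{4\pi\,(2n)!}}\;\frac{(1+\delta)^{p+1-N}\rho^{p+1}}{(1-\rho)\,r^{n+1}}\qquad\text{for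 all integers } p\ge N. \tag{$*$}$$ 2. There is a monic real polynomial $q$ of degree $2n+2$, depending only on $n$, such that $(*)$ holds for all $0<\delta\le 1$, all $m\in\{-n,\dots,n\}$ and all $\mathbf r\neq 0$, $\mathrm{d}\mathbf r\ne 0$ with $(1+\delta)\rho<1$. 3. For any $0<\delta\le 1$ and any $\rho_0<1$ there is a monic real polynomial $q$ of degree $2n+2$, depending only on $n$, $\delta$ and $\rho_0$, such that $(*)$ holds for all $m\in\{-n,\dots,n\}$ and all $\mathbf r\neq 0$, $\mathrm{d}\mathbf r\ne 0$ with $\rho\le\rho_0$. In particular, for all such $m,\mathbf r,\mathrm{d}\mathbf r$ with $\rho<1$ and every $0<\delta\le 1$ there is a monic $q$ of degree $2n+2$ for which $(*)$ holds. -/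

import Mathlib

open Polynomial

noncomputable section

/-- Points of three-dimensional Euclidean space. -/
abbrev Space3 : Type := EuclideanSpace ℝ (Fin 3)

/-- The Legendre polynomial `P_n`, by Rodrigues' formula
`P_n = (1 / (2 ^ n n!)) (d/dx)^n (x ^ 2 - 1) ^ n`. -/
def legendrePoly (n : ℕ) : ℝ[X] :=
  C (1 / (2 ^ n * (n.factorial : ℝ))) * derivative^[n] ((X ^ 2 - 1) ^ n)

/-- The associated Legendre function `P_n^k` on `[-1, 1]` for orders `k ≥ 0`:
`(-1)^k (1 - x ^ 2)^(k/2) (d/dx)^k P_n(x)`. -/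
def assocLegendreNonneg (n k : ℕ) (x : ℝ) : ℝ :=
  (-1) ^ k * Real.sqrt (1 - x ^ 2) ^ k * (derivative^[k] (legendrePoly n)).eval x

/-- The associated Legendre function `P_n^m` on `[-1, 1]` for orders `-n ≤ m ≤ n`; for `k ≥ 0`,
`P_n^{-k} = (-1)^k ((n - k)! / (n + k)!) P_n^k`. -/
def assocLegendre (n : ℕ) (m : ℤ) (x : ℝ) : ℝ :=
  if 0 ≤ m then assocLegendreNonneg n m.natAbs x
  else (-1) ^ m.natAbs * (((n - m.natAbs).factorial : ℝ) / ((n + m.natAbs).factorial : ℝ)) *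
    assocLegendreNonneg n m.natAbs x

/-- The spherical harmonic `Y_n^m(θ, φ)`, for `-n ≤ m ≤ n`. -/
def sphericalHarmonic (n : ℕ) (m : ℤ) (θ φ : ℝ) : ℂ :=
  (Real.sqrt ((2 * (n : ℝ) + 1) / (4 * Real.pi) *
      ((((n : ℤ) - m).toNat.factorial : ℝ) / (((n : ℤ) + m).toNat.factorial : ℝ))) : ℂ) *
    (assocLegendre n m (Real.cos θ) : ℂ) * Complex.exp (Complex.I * (m : ℂ) * (φ : ℂ))

/-- The polar angle `θ ∈ [0, π]` of a point. -/
def polarAngle (v : Space3) : ℝ := Real.arccos (v 2 / ‖v‖)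

/-- An azimuthal angle of a point. The value is taken in `(-π, π]`; since `Y_n^m(θ, φ)` is
`2π`-periodic in `φ`, this gives the same harmonics as the representative in `[0, 2π)`. -/
def azimuth (v : Space3) : ℝ := Complex.arg ⟨v 0, v 1⟩

/-- `Y_n^m(v̂)`, the spherical harmonic at the direction of `v`. -/
def sphericalHarmonicDir (n : ℕ) (m : ℤ) (v : Space3) : ℂ :=
  sphericalHarmonic n m (polarAngle v) (azimuth v)

/-- The irregular solid harmonic `I_n^m(v) = Y_n^m(v̂) / ‖v‖ ^ (n + 1)`. -/
def irregularSolid (n : ℕ) (m : ℤ) (v : Space3) : ℂ :=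
  sphericalHarmonicDir n m v / ((‖v‖ ^ (n + 1) : ℝ) : ℂ)

/-- The regular solid harmonic `R_n^m(v) = ‖v‖ ^ n Y_n^m(v̂)`. -/
def regularSolid (n : ℕ) (m : ℤ) (v : Space3) : ℂ :=
  ((‖v‖ ^ n : ℝ) : ℂ) * sphericalHarmonicDir n m v

/-- The coefficient `c_{νμ}` (for fixed `n`, `m` with `|m| ≤ n` and `|μ| ≤ ν`, so that all entries
of the binomial coefficients are nonnegative). -/
def translationCoeff (n : ℕ) (m : ℤ) (ν : ℕ) (μ : ℤ) : ℝ :=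
  Real.sqrt ((2 * (n : ℝ) + 1) / (2 * (n : ℝ) + 2 * (ν : ℝ) + 1) *
    (Nat.choose ((n : ℤ) + m + ν - μ).toNat ((ν : ℤ) - μ).toNat : ℝ) *
    (Nat.choose ((n : ℤ) - m + ν + μ).toNat ((ν : ℤ) + μ).toNat : ℝ))

/-- The `ν`-th term of the translation expansion, including the prefactor `2 √π`. -/
def translationTerm (n : ℕ) (m : ℤ) (r dr : Space3) (ν : ℕ) : ℂ :=
  ((2 * Real.sqrt Real.pi : ℝ) : ℂ) * ∑ μ ∈ Finset.Icc (-(ν : ℤ)) (ν : ℤ),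
    (-1 : ℂ) ^ ((ν : ℤ) + μ) * (translationCoeff n m ν μ : ℂ) /
        (Real.sqrt (2 * (ν : ℝ) + 1) : ℂ) *
      regularSolid ν μ dr * irregularSolid (n + ν) (m - μ) r

/-- The truncation error `ε_p`: the modulus of the tail `ν ≥ p + 1` of the expansion. -/
def truncationError (n : ℕ) (m : ℤ) (r dr : Space3) (p : ℕ) : ℝ :=
  ‖∑' k : ℕ, translationTerm n m r dr (p + 1 + k)‖

/-- The threshold `N_δ^{(n)} = (n + 1) / δ`. -/
def truncationThreshold (n : ℕ) (δ : ℝ) : ℝ := ((n : ℝ) + 1) / δ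

/-- The bound
`√(3 q(2N) / (4 π (2n)!)) (1 + δ)^(p + 1 - N) ρ^(p + 1) / ((1 - ρ) r^(n + 1))` with
`N = N_δ^{(n)}`, where `r` and `ρ` are real numbers. -/
def truncationBound (n : ℕ) (q : ℝ[X]) (δ ρ r : ℝ) (p : ℕ) : ℝ :=
  Real.sqrt (3 * q.eval (2 * truncationThreshold n δ) /
      (4 * Real.pi * ((2 * n).factorial : ℝ))) *
    ((1 + δ) ^ ((p : ℝ) + 1 - truncationThreshold n δ) * ρ ^ (p + 1) /
      ((1 - ρ) * r ^ (n + 1)))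

end

/-!
The idea is to read the harmonics of degree `n` as the coefficients of `σ_v ^ n`, where `σ_v` is the
Laurent polynomial `z - (w / 2) T + (w̄ / 2) T⁻¹` with `w = x + i y`; multiplying by `σ_d` acts on
sequences by `ladder d`. Up to normalisation the irregular harmonics satisfy
`∂_d I_n = ladder d I_{n+1}`, so the `ν`-th directional derivative `∂_d ^ ν I_n` is the convolution
of the coefficients of `σ_d ^ ν` with `I_{n+ν}`: the translation series is the Taylor series along
the segment from `r` to `r + d`.

The Cauchy–Schwarz inequality together with Unsöld's identity (the weighted square sum of the
harmonics of a given degree is explicit) bounds the `ν`-th term by a polynomial of degree `n` in `ν`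
times `(|d| / |r|) ^ ν / |r| ^ (n + 1)`. This bound controls both the Taylor remainder and the tail
of the series, and powers of `p` are absorbed in `(1 + δ) ^ (p + 1 - N)`.
-/

noncomputable section

open scoped ComplexConjugate

/-! ### Ladder operators and regular harmonics -/

/-- The complex coordinate `x + i y` of the horizontal part of a point. -/
def planar (v : Space3) : ℂ := ⟨v 0, v 1⟩

theorem normSq_planar_add_sq (v : Space3) :
    planar v * conj (planar v) + (v 2 : ℂ) ^ 2 = (‖v‖ : ℂ) ^ 2 := by
  have h : ‖v‖ ^ 2 = Complex.normSq (planar v) + v 2 ^ 2 := by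
    rw [EuclideanSpace.real_norm_sq_eq, Fin.sum_univ_three, Complex.normSq_apply, planar]
    ring
  rw [Complex.mul_conj]
  exact_mod_cast h.symm

theorem inner_eq_planar (v d : Space3) :
    ((inner ℝ v d : ℝ) : ℂ) =
      v 2 * d 2 + (planar v * conj (planar d) + conj (planar v) * planar d) / 2 := by
  have h : inner ℝ v d = v 2 * d 2 + (planar v * conj (planar d)).re := by
    rw [PiLp.inner_apply, Fin.sum_univ_three, Complex.mul_re]
    simp only [planar, Complex.conj_re, Complex.conj_im, RCLike.inner_apply, conj_trivial]
    ring
  rw [h, Complex.ofReal_add, Complex.ofReal_mul, Complex.re_eq_add_conj, map_mul, Complex.conj_conj]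

@[simp] theorem planar_line (r d : Space3) (t : ℝ) :
    planar (r + t • d) = planar r + t * planar d := by
  apply Complex.ext <;> simp [planar]

/-- The ladder operator: multiplication of a sequence, seen as the coefficients of a formal Laurent
series in `T`, by the symbol `z - (w / 2) T + (w̄ / 2) T⁻¹`, where `w = planar v` and `z = v 2`. -/
def ladder (v : Space3) (f : ℤ → ℂ) (m : ℤ) : ℂ :=
  v 2 * f m + conj (planar v) / 2 * f (m + 1) - planar v / 2 * f (m - 1)

theorem ladder_const_mul (v : Space3) (c : ℂ) (f : ℤ → ℂ) (m : ℤ) :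
    ladder v (fun k => c * f k) m = c * ladder v f m := by
  simp only [ladder]
  ring

theorem ladder_comm (v d : Space3) (f : ℤ → ℂ) :
    ladder v (ladder d f) = ladder d (ladder v f) := by
  ext m
  simp only [ladder, add_sub_cancel_right, sub_add_cancel]
  ring

/-- The unnormalised regular solid harmonic: the coefficient of `T ^ m` in the `n`-th power of the
symbol of `ladder v`. -/
def regularHarm (v : Space3) (n : ℕ) : ℤ → ℂ := (ladder v)^[n] (Pi.single 0 1)

@[simp] theorem regularHarm_zero (v : Space3) : regularHarm v 0 = Pi.single 0 1 := rfl

theorem regularHarm_succ (v : Space3) (n : ℕ) :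
    regularHarm v (n + 1) = ladder v (regularHarm v n) :=
  Function.iterate_succ_apply' ..

theorem regularHarm_succ_apply (v : Space3) (n : ℕ) (m : ℤ) :
    regularHarm v (n + 1) m = v 2 * regularHarm v n m
      + conj (planar v) / 2 * regularHarm v n (m + 1) - planar v / 2 * regularHarm v n (m - 1) :=
  congrFun (regularHarm_succ v n) m

theorem regularHarm_eq_zero (v : Space3) {n : ℕ} {m : ℤ} (hm : (n : ℤ) < |m|) :
    regularHarm v n m = 0 := by
  induction n generalizing m with
  | zero => exact Pi.single_eq_of_ne (abs_pos.1 hm) 1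
  | succ n ih =>
    rw [regularHarm_succ, ladder, ih (by grind), ih (by grind), ih (by grind)]
    simp

theorem regularHarm_neg (v : Space3) (n : ℕ) (m : ℤ) :
    regularHarm v n (-m) = (-1) ^ m * conj (regularHarm v n m) := by
  induction n generalizing m with
  | zero => rcases eq_or_ne m 0 with rfl | hm <;> simp [*]
  | succ n ih =>
    rw [regularHarm_succ_apply, regularHarm_succ_apply, show -m + 1 = -(m - 1) by ring,
      show -m - 1 = -(m + 1) by ring, ih, ih, ih,
      zpow_add_one₀ (neg_ne_zero.2 one_ne_zero), zpow_sub_one₀ (neg_ne_zero.2 one_ne_zero)]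
    simp only [map_sub, map_add, map_mul, map_div₀, map_ofNat, Complex.conj_ofReal,
      Complex.conj_conj, inv_neg_one]
    ring

/-- Compare coefficients in `T ∂_T (σ ^ n) = n σ ^ (n - 1) T ∂_T σ`, with `σ` the symbol of
`ladder v`. -/
theorem order_mul_regularHarm (v : Space3) (n : ℕ) (m : ℤ) :
    m * regularHarm v n m = -n *
      (planar v / 2 * regularHarm v (n - 1) (m - 1)
        + conj (planar v) / 2 * regularHarm v (n - 1) (m + 1)) := by
  induction n generalizing m with
  | zero => rcases eq_or_ne m 0 with rfl | hm <;> simp [*]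
  | succ n ih =>
    have hladder : (n : ℂ) * (planar v / 2 * regularHarm v n (m - 1)
        + conj (planar v) / 2 * regularHarm v n (m + 1)) =
        n * ladder v (fun k => planar v / 2 * regularHarm v (n - 1) (k - 1)
          + conj (planar v) / 2 * regularHarm v (n - 1) (k + 1)) m := by
      rcases n with _ | n
      · simp
      · simp only [regularHarm_succ_apply, ladder, add_tsub_cancel_right, sub_add_cancel]
        ring
    have hsucc := ih (m + 1)
    have hpred := ih (m - 1)
    rw [regularHarm_succ_apply]
    rw [ladder] at hladder
    push_cast at hsucc hpred ⊢
    simp only [add_sub_cancel_right, sub_add_cancel] at hsucc hpred hladder ⊢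
    linear_combination (v 2 : ℂ) * ih m + conj (planar v) / 2 * hsucc - planar v / 2 * hpred
      + hladder

theorem degree_add_order_mul_regularHarm (v : Space3) (n : ℕ) (m : ℤ) :
    (n + m) * regularHarm v n m =
      n * (v 2 * regularHarm v (n - 1) m - planar v * regularHarm v (n - 1) (m - 1)) := by
  have horder := order_mul_regularHarm v n m
  rcases n with _ | n
  · simpa using horder
  rw [add_tsub_cancel_right] at *
  linear_combination horder + ((n + 1 : ℕ) : ℂ) * regularHarm_succ_apply v n m

theorem degree_sub_order_mul_regularHarm (v : Space3) (n : ℕ) (m : ℤ) :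
    (n - m) * regularHarm v n m =
      n * (v 2 * regularHarm v (n - 1) m + conj (planar v) * regularHarm v (n - 1) (m + 1)) := by
  have horder := order_mul_regularHarm v n m
  rcases n with _ | n
  · simpa using horder
  rw [add_tsub_cancel_right] at *
  linear_combination ((n + 1 : ℕ) : ℂ) * regularHarm_succ_apply v n m - horder

theorem regularHarm_succ_same_order (v : Space3) (n : ℕ) (m : ℤ) :
    (n + 1 - m) * (n + 1 + m) * regularHarm v (n + 1) m =
      (n + 1) * ((2 * n + 1) * v 2 * regularHarm v n m
        - n * ‖v‖ ^ 2 * regularHarm v (n - 1) m) := by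
  have hadd_succ := degree_add_order_mul_regularHarm v (n + 1) m
  have hsub_pred := degree_sub_order_mul_regularHarm v n (m - 1)
  have hadd := degree_add_order_mul_regularHarm v n m
  rw [add_tsub_cancel_right] at hadd_succ
  rw [sub_add_cancel] at hsub_pred
  push_cast at hadd_succ hsub_pred
  rw [← normSq_planar_add_sq]
  linear_combination (n + 1 - m) * hadd_succ - (n + 1) * planar v * hsub_pred - (n + 1) * v 2 * hadd

theorem regularHarm_succ_order_add_one (v : Space3) (n : ℕ) (m : ℤ) :
    (n + m + 2) * (n + m + 1) * regularHarm v (n + 1) (m + 1) =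
      (n + 1) * (n * ‖v‖ ^ 2 * regularHarm v (n - 1) (m + 1)
        - (2 * n + 1) * planar v * regularHarm v n m) := by
  have hadd_succ := degree_add_order_mul_regularHarm v (n + 1) (m + 1)
  have hadd := degree_add_order_mul_regularHarm v n (m + 1)
  have hsub := degree_sub_order_mul_regularHarm v n m
  rw [add_tsub_cancel_right, add_sub_cancel_right] at hadd_succ
  rw [add_sub_cancel_right] at hadd
  push_cast at hadd_succ hadd
  rw [← normSq_planar_add_sq]
  linear_combination (n + m + 1) * hadd_succ + (n + 1) * v 2 * hadd + (n + 1) * planar v * hsub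

theorem regularHarm_succ_order_sub_one (v : Space3) (n : ℕ) (m : ℤ) :
    (n - m + 2) * (n - m + 1) * regularHarm v (n + 1) (m - 1) =
      (n + 1) * (n * ‖v‖ ^ 2 * regularHarm v (n - 1) (m - 1)
        + (2 * n + 1) * conj (planar v) * regularHarm v n m) := by
  have hsub_succ := degree_sub_order_mul_regularHarm v (n + 1) (m - 1)
  have hsub := degree_sub_order_mul_regularHarm v n (m - 1)
  have hadd := degree_add_order_mul_regularHarm v n m
  rw [add_tsub_cancel_right, sub_add_cancel] at hsub_succ
  rw [sub_add_cancel] at hsub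
  push_cast at hsub_succ hsub
  rw [← normSq_planar_add_sq]
  linear_combination (n - m + 1) * hsub_succ + (n + 1) * v 2 * hsub
    - (n + 1) * conj (planar v) * hadd

theorem ladder_line (r d : Space3) (t : ℝ) (f : ℤ → ℂ) (m : ℤ) :
    ladder (r + t • d) f m = ladder r f m + t * ladder d f m := by
  simp only [ladder, planar_line, PiLp.add_apply, PiLp.smul_apply, smul_eq_mul, map_add, map_mul,
    Complex.conj_ofReal]
  push_cast
  ring

theorem hasDerivAt_ladder {F : ℝ → ℤ → ℂ} {F' : ℤ → ℂ} {t : ℝ}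
    (hF : ∀ m, HasDerivAt (fun t => F t m) (F' m) t) (d : Space3) (m : ℤ) :
    HasDerivAt (fun t => ladder d (F t) m) (ladder d F' m) t :=
  (((hF m).const_mul _).add ((hF (m + 1)).const_mul _)).sub ((hF (m - 1)).const_mul _)

theorem hasDerivAt_regularHarm_line (n : ℕ) (m : ℤ) (r d : Space3) (t : ℝ) :
    HasDerivAt (fun t : ℝ => regularHarm (r + t • d) n m)
      (n * ladder d (regularHarm (r + t • d) (n - 1)) m) t := by
  induction n generalizing m with
  | zero => simpa using hasDerivAt_const t _
  | succ n ih =>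
    have hladder : n * ladder (r + t • d) (ladder d (regularHarm (r + t • d) (n - 1))) m =
        n * ladder d (regularHarm (r + t • d) n) m := by
      rcases n with _ | n
      · simp
      · rw [ladder_comm, add_tsub_cancel_right, ← regularHarm_succ]
    rw [ladder_line] at hladder
    simp only [regularHarm_succ, ladder_line]
    refine ((hasDerivAt_ladder ih r m).add
      ((hasDerivAt_id t).ofReal_comp.mul (hasDerivAt_ladder ih d m))).congr_deriv ?_
    rw [add_tsub_cancel_right, ladder_const_mul, ladder_const_mul]
    push_cast [id]
    linear_combination hladder

/-! ### Irregular harmonics -/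

/-- The factor `(n - m)! (n + m)!` relating regular, irregular and normalised harmonics, for
`|m| ≤ n`. -/
def factorialProd (n : ℕ) (m : ℤ) : ℝ :=
  ((n : ℤ) - m).toNat.factorial * ((n : ℤ) + m).toNat.factorial

theorem factorialProd_pos (n : ℕ) (m : ℤ) : 0 < factorialProd n m := by
  unfold factorialProd
  positivity

theorem factorialProd_neg (n : ℕ) (m : ℤ) : factorialProd n (-m) = factorialProd n m := by
  rw [factorialProd, factorialProd, sub_neg_eq_add, ← sub_eq_add_neg, mul_comm]

theorem factorialProd_succ {n : ℕ} {m : ℤ} (hm : |m| ≤ (n : ℤ)) :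
    factorialProd (n + 1) m = (n + 1 - m) * (n + 1 + m) * factorialProd n m := by
  obtain ⟨hneg, hpos⟩ := abs_le.1 hm
  obtain ⟨a, ha⟩ := Int.eq_ofNat_of_zero_le (sub_nonneg.2 hpos)
  obtain ⟨b, hb⟩ := Int.eq_ofNat_of_zero_le (neg_le_iff_add_nonneg'.1 hneg)
  have ha' : ((n : ℝ) - m) = a := by exact_mod_cast ha
  have hb' : ((n : ℝ) + m) = b := by exact_mod_cast hb
  rw [factorialProd, factorialProd, show ((n + 1 : ℕ) : ℤ) - m = (a + 1 : ℕ) by grind,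
    show ((n + 1 : ℕ) : ℤ) + m = (b + 1 : ℕ) by grind, ha, hb,
    show (n + 1 - m : ℝ) = a + 1 by linarith, show (n + 1 + m : ℝ) = b + 1 by linarith]
  simp only [Int.toNat_natCast, Nat.factorial_succ]
  push_cast
  ring

theorem factorialProd_succ_add_one {n : ℕ} {m : ℤ} (hm : |m| ≤ (n : ℤ)) :
    factorialProd (n + 1) (m + 1) = (n + m + 2) * (n + m + 1) * factorialProd n m := by
  obtain ⟨b, hb⟩ := Int.eq_ofNat_of_zero_le (neg_le_iff_add_nonneg'.1 (abs_le.1 hm).1)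
  have hb' : ((n : ℝ) + m) = b := by exact_mod_cast hb
  rw [factorialProd, factorialProd, show ((n + 1 : ℕ) : ℤ) - (m + 1) = n - m by grind,
    show ((n + 1 : ℕ) : ℤ) + (m + 1) = (b + 2 : ℕ) by grind, hb, hb']
  simp only [Int.toNat_natCast, Nat.factorial_succ]
  push_cast
  ring

theorem factorialProd_succ_sub_one {n : ℕ} {m : ℤ} (hm : |m| ≤ (n : ℤ)) :
    factorialProd (n + 1) (m - 1) = (n - m + 2) * (n - m + 1) * factorialProd n m := by
  rw [← factorialProd_neg, neg_sub', sub_neg_eq_add, factorialProd_succ_add_one (by rwa [abs_neg]),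
    factorialProd_neg]
  push_cast
  ring

/-- The numerator `‖v‖ ^ (2 n + 1) I_n^m(v)` of the unnormalised irregular solid harmonic. The
factor `(-1) ^ (n + m)` makes directional derivatives act by `ladder` without signs. -/
def irregularNumerator (v : Space3) (n : ℕ) (m : ℤ) : ℂ :=
  (-1) ^ ((n : ℤ) + m) * factorialProd n m / n.factorial * regularHarm v n m

theorem ladder_irregularNumerator (v d : Space3) {n : ℕ} {m : ℤ} (hm : |m| ≤ (n : ℤ)) :
    ladder d (irregularNumerator v (n + 1)) m =
      (-1) ^ ((n : ℤ) + m) * factorialProd n m / n.factorial *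
        (‖v‖ ^ 2 * (n * ladder d (regularHarm v (n - 1)) m)
          - (2 * n + 1) * (inner ℝ v d : ℝ) * regularHarm v n m) := by
  have hfact : ((n.factorial : ℕ) : ℂ) ≠ 0 := by exact_mod_cast n.factorial_ne_zero
  have hn : (n + 1 : ℂ) ≠ 0 := by exact_mod_cast n.succ_ne_zero
  have hsame := regularHarm_succ_same_order v n m
  have hadd := regularHarm_succ_order_add_one v n m
  have hsub := regularHarm_succ_order_sub_one v n m
  have hsign : (-1 : ℂ) ^ (((n + 1 : ℕ) : ℤ) + m) = -(-1) ^ ((n : ℤ) + m) := by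
    rw [Nat.cast_succ, add_right_comm, zpow_add_one₀ (by norm_num)]
    ring
  have hsign_add : (-1 : ℂ) ^ (((n + 1 : ℕ) : ℤ) + (m + 1)) = (-1) ^ ((n : ℤ) + m) := by
    rw [← add_assoc, zpow_add_one₀ (by norm_num), hsign]
    ring
  have hsign_sub : (-1 : ℂ) ^ (((n + 1 : ℕ) : ℤ) + (m - 1)) = (-1) ^ ((n : ℤ) + m) := by
    rw [Nat.cast_succ, add_assoc, add_sub_cancel]
  simp only [ladder, irregularNumerator, hsign, hsign_add, hsign_sub, factorialProd_succ hm,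
    factorialProd_succ_add_one hm, factorialProd_succ_sub_one hm, inner_eq_planar,
    Nat.factorial_succ]
  push_cast
  field_simp
  linear_combination (factorialProd n m : ℂ) *
    (-2 * d 2 * hsame + conj (planar d) * hadd - planar d * hsub)

/-- The unnormalised irregular solid harmonic, homogeneous of degree `-(n + 1)`. -/
def irregularHarm (v : Space3) (n : ℕ) (m : ℤ) : ℂ :=
  irregularNumerator v n m / ‖v‖ ^ (2 * n + 1)

theorem hasDerivAt_irregularHarm_line {n : ℕ} {m : ℤ} (hm : |m| ≤ (n : ℤ)) (r d : Space3) (t : ℝ)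
    (hv : r + t • d ≠ 0) :
    HasDerivAt (fun t : ℝ => irregularHarm (r + t • d) n m)
      (ladder d (irregularHarm (r + t • d) (n + 1)) m) t := by
  have hv' : (‖r + t • d‖ : ℂ) ≠ 0 := by simpa using hv
  have hline : HasDerivAt (fun t : ℝ => r + t • d) d t := by
    simpa using ((hasDerivAt_id t).smul_const d).const_add r
  have hnorm : HasDerivAt (fun t : ℝ => ‖r + t • d‖) (inner ℝ (r + t • d) d / ‖r + t • d‖) t := by
    have h := hline.norm_sq.sqrt (by simpa using hv)
    simp only [Real.sqrt_sq (norm_nonneg _)] at h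
    refine h.congr_deriv ?_
    field_simp
  have hdiv := ((hasDerivAt_regularHarm_line n m r d t).const_mul
    ((-1 : ℂ) ^ ((n : ℤ) + m) * factorialProd n m / n.factorial)).div
    (hnorm.ofReal_comp.fun_pow (2 * n + 1)) (pow_ne_zero _ hv')
  refine hdiv.congr_deriv ?_
  have hladder : ladder d (irregularHarm (r + t • d) (n + 1)) m =
      ladder d (irregularNumerator (r + t • d) (n + 1)) m / ‖r + t • d‖ ^ (2 * n + 3) := by
    simp only [ladder, irregularHarm, show 2 * (n + 1) + 1 = 2 * n + 3 by ring]
    ring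
  rw [hladder, ladder_irregularNumerator _ _ hm]
  push_cast
  field_simp
  ring

/-! ### The Taylor terms and their size -/

theorem sum_Icc_comp_add {R : Type*} [NonUnitalNonAssocSemiring R] {ν : ℕ} {f : ℤ → R}
    (hf : ∀ μ : ℤ, (ν : ℤ) < |μ| → f μ = 0) (g : ℤ → R) {e : ℤ} (he : |e| ≤ 1) :
    ∑ μ ∈ Finset.Icc (-((ν + 1 : ℕ) : ℤ)) (ν + 1 : ℕ), f (μ + e) * g μ =
      ∑ μ ∈ Finset.Icc (-(ν : ℤ)) ν, f μ * g (μ - e) := by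
  symm
  refine Finset.sum_of_injOn (· - e) (sub_left_injective.injOn) ?_ ?_ ?_
  · intro μ hμ
    simp only [Finset.coe_Icc, Set.mem_Icc] at hμ ⊢
    grind
  · intro μ _ hμ
    rw [hf, zero_mul]
    by_contra! h
    exact hμ ⟨μ + e, by simpa [abs_le] using h, add_sub_cancel_right μ e⟩
  · simp

theorem sum_ladder_mul (d : Space3) {ν : ℕ} {f : ℤ → ℂ} (hf : ∀ μ : ℤ, (ν : ℤ) < |μ| → f μ = 0)
    (g : ℤ → ℂ) (m : ℤ) :
    ∑ μ ∈ Finset.Icc (-((ν + 1 : ℕ) : ℤ)) (ν + 1 : ℕ), ladder d f μ * g (m - μ) =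
      ∑ μ ∈ Finset.Icc (-(ν : ℤ)) ν, f μ * ladder d g (m - μ) := by
  have hzero := sum_Icc_comp_add hf (fun μ => g (m - μ)) (e := 0) (by simp)
  have hone := sum_Icc_comp_add hf (fun μ => g (m - μ)) (e := 1) (by simp)
  have hneg_one := sum_Icc_comp_add hf (fun μ => g (m - μ)) (e := -1) (by simp)
  simp only [add_zero, sub_zero, ← sub_add, sub_neg_eq_add, ← sub_eq_add_neg, ← sub_sub]
    at hzero hone hneg_one
  simp only [ladder, add_mul, sub_mul, mul_add, mul_sub, mul_assoc, mul_left_comm (f _),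
    Finset.sum_add_distrib, Finset.sum_sub_distrib, ← Finset.mul_sum, hzero, hone, hneg_one]

/-- The `ν`-th term of the translation expansion of the unnormalised irregular harmonic; it is the
`ν`-th Taylor coefficient at `v` in the direction `d`. -/
def expansionTerm (n : ℕ) (m : ℤ) (d : Space3) (ν : ℕ) (v : Space3) : ℂ :=
  (∑ μ ∈ Finset.Icc (-(ν : ℤ)) ν, regularHarm d ν μ * irregularHarm v (n + ν) (m - μ)) /
    ν.factorial

theorem hasDerivAt_expansionTerm_line {n : ℕ} {m : ℤ} (hm : |m| ≤ (n : ℤ)) (r d : Space3) (ν : ℕ)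
    (t : ℝ) (hv : r + t • d ≠ 0) :
    HasDerivAt (fun t : ℝ => expansionTerm n m d ν (r + t • d))
      ((ν + 1 : ℕ) * expansionTerm n m d (ν + 1) (r + t • d)) t := by
  have hsum := (HasDerivAt.fun_sum fun μ (hμ : μ ∈ Finset.Icc (-(ν : ℤ)) ν) =>
    (hasDerivAt_irregularHarm_line (n := n + ν) (m := m - μ)
      (by rw [Finset.mem_Icc] at hμ; grind) r d t hv).const_mul (regularHarm d ν μ)).div_const
        (ν.factorial : ℂ)
  refine hsum.congr_deriv ?_
  have hν : (ν + 1 : ℂ) ≠ 0 := by exact_mod_cast ν.succ_ne_zero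
  rw [← sum_ladder_mul d fun _ => regularHarm_eq_zero d, ← regularHarm_succ, expansionTerm,
    Nat.factorial_succ, ← add_assoc]
  push_cast
  field_simp

theorem irregularNumerator_neg (v : Space3) (n : ℕ) (m : ℤ) :
    irregularNumerator v n (-m) =
      (-1) ^ n * factorialProd n m / n.factorial * conj (regularHarm v n m) := by
  have hsign : (-1 : ℂ) ^ ((n : ℤ) + -m) * (-1) ^ m = (-1) ^ n := by
    rw [← zpow_add₀ (by norm_num), neg_add_cancel_right, zpow_natCast]
  rw [irregularNumerator, regularHarm_neg, factorialProd_neg, ← hsign]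
  ring

theorem sum_regularHarm_mul_irregularNumerator (v : Space3) (n : ℕ) :
    ∑ m ∈ Finset.Icc (-(n : ℤ)) n, regularHarm v n m * irregularNumerator v n (0 - m) =
      (-1) ^ n * n.factorial * ‖v‖ ^ (2 * n) := by
  induction n with
  | zero => simp [irregularNumerator, factorialProd]
  | succ n ih =>
    have hladder {m : ℤ} (hm : |m| ≤ n) : ladder v (irregularNumerator v (n + 1)) m =
        -(n + 1) * ‖v‖ ^ 2 * irregularNumerator v n m := by
      have hself : n * ladder v (regularHarm v (n - 1)) m = n * regularHarm v n m := by
        rcases n with _ | n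
        · simp
        · rw [add_tsub_cancel_right, regularHarm_succ]
      rw [ladder_irregularNumerator v v hm, irregularNumerator, hself, real_inner_self_eq_norm_sq]
      push_cast
      ring
    rw [regularHarm_succ, sum_ladder_mul v fun _ => regularHarm_eq_zero v]
    calc _ = ∑ m ∈ Finset.Icc (-(n : ℤ)) n, -(n + 1) * ‖v‖ ^ 2 *
          (regularHarm v n m * irregularNumerator v n (0 - m)) := by
          refine Finset.sum_congr rfl fun m hm => ?_
          rw [hladder (by rw [Finset.mem_Icc] at hm; grind)]
          ring
      _ = _ := by
          rw [← Finset.mul_sum, ih, Nat.factorial_succ]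
          push_cast
          ring

theorem sum_factorialProd_mul_norm_regularHarm_sq (v : Space3) (n : ℕ) :
    ∑ m ∈ Finset.Icc (-(n : ℤ)) n, factorialProd n m * ‖regularHarm v n m‖ ^ 2 =
      n.factorial ^ 2 * ‖v‖ ^ (2 * n) := by
  have hfact : (n.factorial : ℂ) ≠ 0 := by exact_mod_cast n.factorial_ne_zero
  have hsum := sum_regularHarm_mul_irregularNumerator v n
  have hterm (m : ℤ) : regularHarm v n m * irregularNumerator v n (0 - m) =
      (-1) ^ n / n.factorial * ((factorialProd n m * ‖regularHarm v n m‖ ^ 2 : ℝ) : ℂ) := by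
    rw [zero_sub, irregularNumerator_neg]
    push_cast
    rw [← Complex.mul_conj']
    ring
  simp only [hterm, ← Finset.mul_sum, ← Complex.ofReal_sum] at hsum
  rw [div_mul_eq_mul_div, div_eq_iff hfact, mul_assoc, mul_assoc,
    mul_right_inj' (pow_ne_zero _ (by norm_num))] at hsum
  have h : ∑ m ∈ Finset.Icc (-(n : ℤ)) n, factorialProd n m * ‖regularHarm v n m‖ ^ 2 =
      n.factorial * (‖v‖ ^ (2 * n) * n.factorial) := by exact_mod_cast hsum
  rw [h]
  ring

theorem factorialProd_add_sub_le {n ν : ℕ} {m μ : ℤ} (hm : |m| ≤ (n : ℤ)) (hμ : |μ| ≤ (ν : ℤ)) :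
    factorialProd (n + ν) (m - μ) ≤ (2 * n + 2 * ν : ℝ) ^ (2 * n) * factorialProd ν μ := by
  have hfact (a k : ℕ) (h : a + k ≤ 2 * n + 2 * ν) :
      (((a + k).factorial : ℕ) : ℝ) ≤ (2 * n + 2 * ν : ℝ) ^ k * a.factorial := by
    have : (a + k).factorial ≤ (2 * n + 2 * ν) ^ k * a.factorial := by
      rw [← Nat.factorial_mul_ascFactorial, mul_comm]
      gcongr
      exact (Nat.ascFactorial_le_pow_add a k).trans (Nat.pow_le_pow_left h k)
    exact_mod_cast this
  rw [abs_le] at hm hμ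
  have hleft := hfact ((ν : ℤ) + μ).toNat ((n : ℤ) - m).toNat (by omega)
  have hright := hfact ((ν : ℤ) - μ).toNat ((n : ℤ) + m).toNat (by omega)
  rw [← Int.toNat_add (by omega) (by omega)] at hleft hright
  have hexp : 2 * n = ((n : ℤ) - m).toNat + ((n : ℤ) + m).toNat := by omega
  calc factorialProd (n + ν) (m - μ)
      = ((ν : ℤ) + μ + (n - m)).toNat.factorial * ((ν : ℤ) - μ + (n + m)).toNat.factorial := by
        rw [factorialProd]
        congr! 4 <;> push_cast <;> ring
    _ ≤ _ := mul_le_mul hleft hright (by positivity) (by positivity)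
    _ = _ := by
        rw [hexp, pow_add, factorialProd]
        ring

theorem sum_norm_irregularHarm_sq_div_factorialProd {v : Space3} (hv : v ≠ 0) (n : ℕ) :
    ∑ m ∈ Finset.Icc (-(n : ℤ)) n, ‖irregularHarm v n m‖ ^ 2 / factorialProd n m =
      1 / (‖v‖ ^ (n + 1)) ^ 2 := by
  have : ‖v‖ ≠ 0 := norm_ne_zero_iff.2 hv
  have hterm (m : ℤ) : ‖irregularHarm v n m‖ ^ 2 / factorialProd n m =
      factorialProd n m * ‖regularHarm v n m‖ ^ 2 / (n.factorial * ‖v‖ ^ (2 * n + 1)) ^ 2 := by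
    have hF := factorialProd_pos n m
    simp only [irregularHarm, irregularNumerator, norm_div, norm_mul, norm_zpow, norm_neg, norm_one,
      one_zpow, norm_pow, Complex.norm_real, norm_norm, Complex.norm_natCast,
      Real.norm_of_nonneg hF.le]
    field_simp
  simp only [hterm, ← Finset.sum_div, sum_factorialProd_mul_norm_regularHarm_sq]
  field_simp
  ring

theorem sum_norm_irregularHarm_sub_sq_div_factorialProd_le {n : ℕ} {m : ℤ} (hm : |m| ≤ (n : ℤ))
    {v : Space3} (hv : v ≠ 0) (ν : ℕ) :
    ∑ μ ∈ Finset.Icc (-(ν : ℤ)) ν,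
        ‖irregularHarm v (n + ν) (m - μ)‖ ^ 2 / factorialProd ν μ ≤
      (2 * n + 2 * ν : ℝ) ^ (2 * n) / (‖v‖ ^ (n + ν + 1)) ^ 2 := by
  have hF := factorialProd_pos
  calc _ ≤ ∑ μ ∈ Finset.Icc (-(ν : ℤ)) ν, (2 * n + 2 * ν : ℝ) ^ (2 * n) *
          (‖irregularHarm v (n + ν) (m - μ)‖ ^ 2 / factorialProd (n + ν) (m - μ)) := by
        refine Finset.sum_le_sum fun μ hμ => ?_
        have hle := factorialProd_add_sub_le hm (abs_le.2 (Finset.mem_Icc.1 hμ))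
        rw [mul_div_left_comm]
        refine (div_eq_mul_inv _ _).trans_le (mul_le_mul_of_nonneg_left ?_ (sq_nonneg _))
        rwa [le_div_iff₀ (hF _ _), inv_mul_le_iff₀ (hF _ _), mul_comm (factorialProd ν μ)]
    _ = ∑ k ∈ (Finset.Icc (-(ν : ℤ)) ν).image (m - ·), (2 * n + 2 * ν : ℝ) ^ (2 * n) *
          (‖irregularHarm v (n + ν) k‖ ^ 2 / factorialProd (n + ν) k) := by
        rw [Finset.sum_image sub_right_injective.injOn]
    _ ≤ ∑ k ∈ Finset.Icc (-((n + ν : ℕ) : ℤ)) (n + ν : ℕ), (2 * n + 2 * ν : ℝ) ^ (2 * n) *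
          (‖irregularHarm v (n + ν) k‖ ^ 2 / factorialProd (n + ν) k) := by
        refine Finset.sum_le_sum_of_subset_of_nonneg ?_ fun k _ _ =>
          mul_nonneg (by positivity) (div_nonneg (sq_nonneg _) (hF _ _).le)
        rw [abs_le] at hm
        intro k hk
        obtain ⟨μ, hμ, rfl⟩ := Finset.mem_image.1 hk
        rw [Finset.mem_Icc] at hμ ⊢
        grind
    _ = _ := by
        rw [← Finset.mul_sum, sum_norm_irregularHarm_sq_div_factorialProd hv, mul_one_div]

theorem norm_expansionTerm_le {n : ℕ} {m : ℤ} (hm : |m| ≤ (n : ℤ)) (d : Space3) (ν : ℕ)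
    {v : Space3} (hv : v ≠ 0) :
    ‖expansionTerm n m d ν v‖ ≤
      (2 * n + 2 * ν : ℝ) ^ n * (‖d‖ / ‖v‖) ^ ν / ‖v‖ ^ (n + 1) := by
  have hcauchy := Finset.sum_sq_le_sum_mul_sum_of_sq_le_mul (Finset.Icc (-(ν : ℤ)) ν)
    (r := fun μ => ‖regularHarm d ν μ‖ * ‖irregularHarm v (n + ν) (m - μ)‖)
    (f := fun μ => factorialProd ν μ * ‖regularHarm d ν μ‖ ^ 2)
    (g := fun μ => ‖irregularHarm v (n + ν) (m - μ)‖ ^ 2 / factorialProd ν μ)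
    (fun μ _ => mul_nonneg (factorialProd_pos ν μ).le (sq_nonneg _))
    (fun μ _ => div_nonneg (sq_nonneg _) (factorialProd_pos ν μ).le)
    (fun μ _ => by
      have := (factorialProd_pos ν μ).ne'
      exact le_of_eq (by field_simp))
  rw [sum_factorialProd_mul_norm_regularHarm_sq] at hcauchy
  have hsum : ∑ μ ∈ Finset.Icc (-(ν : ℤ)) ν,
      ‖regularHarm d ν μ‖ * ‖irregularHarm v (n + ν) (m - μ)‖ ≤
      ν.factorial * ‖d‖ ^ ν * ((2 * n + 2 * ν : ℝ) ^ n / ‖v‖ ^ (n + ν + 1)) := by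
    refine (abs_le_of_sq_le_sq' ?_ (by positivity)).2
    refine (hcauchy.trans (mul_le_mul_of_nonneg_left
      (sum_norm_irregularHarm_sub_sq_div_factorialProd_le hm hv ν) (by positivity))).trans_eq ?_
    ring
  rw [expansionTerm, norm_div, Complex.norm_natCast, div_le_iff₀ (by positivity)]
  refine (norm_sum_le _ _).trans ?_
  simp only [norm_mul]
  refine hsum.trans_eq ?_
  rw [show n + ν + 1 = ν + (n + 1) by ring, pow_add ‖v‖, div_pow]
  field_simp

/-! ### Convergence of the Taylor expansion -/

/-- All but the last term telescope. -/
theorem hasDerivAt_sum_one_sub_pow_smul {E : Type*} [NormedAddCommGroup E] [NormedSpace ℝ E]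
    {g : ℕ → ℝ → E} {t : ℝ} (hg : ∀ ν, HasDerivAt (g ν) ((ν + 1) • g (ν + 1) t) t) (p : ℕ) :
    HasDerivAt (fun t => ∑ ν ∈ Finset.range (p + 1), (1 - t) ^ ν • g ν t)
      ((p + 1) • (1 - t) ^ p • g (p + 1) t) t := by
  induction p with
  | zero => simpa using hg 0
  | succ p ih =>
    simp only [Finset.sum_range_succ _ (p + 1)]
    have hpow : HasDerivAt (fun t : ℝ => (1 - t) ^ (p + 1)) (-((p + 1 : ℕ) * (1 - t) ^ p)) t := by
      simpa using ((hasDerivAt_id t).const_sub 1).fun_pow (p + 1)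
    refine (ih.add (hpow.smul (hg (p + 1)))).congr_deriv ?_
    module

theorem norm_sub_sum_le_of_hasDerivAt {E : Type*} [NormedAddCommGroup E] [NormedSpace ℝ E]
    {g : ℕ → ℝ → E} (hg : ∀ ν, ∀ t ∈ Set.Icc (0 : ℝ) 1, HasDerivAt (g ν) ((ν + 1) • g (ν + 1) t) t)
    {p : ℕ} {C : ℝ} (hC : ∀ t ∈ Set.Ico (0 : ℝ) 1, ‖(p + 1) • (1 - t) ^ p • g (p + 1) t‖ ≤ C) :
    ‖g 0 1 - ∑ ν ∈ Finset.range (p + 1), g ν 0‖ ≤ C := by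
  have h := norm_image_sub_le_of_norm_deriv_le_segment_01'
    (fun t ht => (hasDerivAt_sum_one_sub_pow_smul (fun ν => hg ν t ht) p).hasDerivWithinAt) hC
  simpa [Finset.sum_range_succ', zero_pow_eq] using h

theorem pow_le_factorial_mul_choose (n k : ℕ) : k ^ n ≤ n.factorial * (k + n).choose n := by
  rw [← Nat.descFactorial_eq_factorial_mul_choose]
  exact (Nat.pow_le_pow_left (by omega) n).trans (Nat.pow_sub_le_descFactorial (k + n) n)

theorem add_pow_mul_geometric_le (n : ℕ) {a x : ℝ} (ha : 0 ≤ a) (hx : 0 ≤ x) (k : ℕ) :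
    (a + k) ^ n * x ^ k ≤
      2 ^ n * (a ^ n * x ^ k + n.factorial * ((k + n).choose n * x ^ k)) := by
  have hchoose : (k : ℝ) ^ n ≤ n.factorial * (k + n).choose n := by
    exact_mod_cast pow_le_factorial_mul_choose n k
  calc (a + k) ^ n * x ^ k ≤ 2 ^ (n - 1) * (a ^ n + (k : ℝ) ^ n) * x ^ k := by
        gcongr
        exact add_pow_le ha k.cast_nonneg n
    _ ≤ 2 ^ n * (a ^ n + n.factorial * (k + n).choose n) * x ^ k := by
        gcongr
        · norm_num
        · exact n.sub_le 1
    _ = _ := by ring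

theorem hasSum_add_factorial_mul_choose_mul_geometric (n : ℕ) (a : ℝ) {x : ℝ} (hx : 0 ≤ x)
    (hx1 : x < 1) :
    HasSum (fun k : ℕ => 2 ^ n * (a ^ n * x ^ k + n.factorial * ((k + n).choose n * x ^ k)))
      (2 ^ n * (a ^ n + n.factorial * (1 / (1 - x)) ^ n) / (1 - x)) := by
  have hchoose := hasSum_choose_mul_geometric_of_norm_lt_one n
    (show ‖x‖ < 1 by rwa [Real.norm_of_nonneg hx])
  have hsum := (((hasSum_geometric_of_lt_one hx hx1).mul_left (a ^ n)).add
    (hchoose.mul_left (n.factorial : ℝ))).mul_left (2 ^ n)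
  rwa [← one_div_pow, pow_succ, ← one_div, ← mul_assoc, ← add_mul, ← mul_assoc, mul_one_div]
    at hsum

theorem summable_add_pow_mul_geometric (n : ℕ) {a x : ℝ} (ha : 0 ≤ a) (hx : 0 ≤ x)
    (hx1 : x < 1) : Summable fun k : ℕ => (a + k) ^ n * x ^ k :=
  .of_nonneg_of_le (fun _ => by positivity) (add_pow_mul_geometric_le n ha hx)
    (hasSum_add_factorial_mul_choose_mul_geometric n a hx hx1).summable

theorem tsum_add_pow_mul_geometric_le (n : ℕ) {a x : ℝ} (ha : 0 ≤ a) (hx : 0 ≤ x) (hx1 : x < 1) :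
    ∑' k : ℕ, (a + k) ^ n * x ^ k ≤
      2 ^ n * (a ^ n + n.factorial * (1 / (1 - x)) ^ n) / (1 - x) :=
  hasSum_le (add_pow_mul_geometric_le n ha hx) (summable_add_pow_mul_geometric n ha hx hx1).hasSum
    (hasSum_add_factorial_mul_choose_mul_geometric n a hx hx1)

theorem norm_sub_mul_norm_le_norm_add_smul {E : Type*} [SeminormedAddCommGroup E] [NormedSpace ℝ E]
    (r d : E) {t : ℝ} (ht : 0 ≤ t) : ‖r‖ - t * ‖d‖ ≤ ‖r + t • d‖ := by
  have := norm_sub_norm_le r (-(t • d))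
  rwa [norm_neg, norm_smul, Real.norm_of_nonneg ht, sub_neg_eq_add] at this

/-- The factor `(1 - t) ^ p` compensates for `r + t d` being closer to the origin than `r`, because
`(1 - t) ‖d‖ / ‖r + t d‖ ≤ ‖d‖ / ‖r‖`. -/
theorem norm_taylorRemainder_le {n : ℕ} {m : ℤ} (hm : |m| ≤ (n : ℤ)) {r d : Space3}
    (hd : ‖d‖ < ‖r‖) (p : ℕ) {t : ℝ} (ht : t ∈ Set.Icc (0 : ℝ) 1) :
    ‖(1 - t) ^ p • expansionTerm n m d (p + 1) (r + t • d)‖ ≤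
      (2 * n + 2 * (p + 1) : ℝ) ^ n * (‖d‖ / ‖r‖) ^ p * ‖d‖ / (‖r‖ - ‖d‖) ^ (n + 2) := by
  have hr : 0 < ‖r‖ := (norm_nonneg d).trans_lt hd
  have hline := norm_sub_mul_norm_le_norm_add_smul r d ht.1
  have hgap : ‖r‖ - ‖d‖ ≤ ‖r + t • d‖ := by nlinarith [ht.2, norm_nonneg d]
  have hgap0 : 0 < ‖r‖ - ‖d‖ := sub_pos.2 hd
  have hv : 0 < ‖r + t • d‖ := hgap0.trans_le hgap
  have ht1 : 0 ≤ 1 - t := sub_nonneg.2 ht.2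
  have hratio : (1 - t) * (‖d‖ / ‖r + t • d‖) ≤ ‖d‖ / ‖r‖ := by
    rw [mul_div_assoc', div_le_div_iff₀ hv hr, mul_comm (1 - t), mul_assoc]
    gcongr
    linarith [mul_le_mul_of_nonneg_left hd.le ht.1]
  rw [norm_smul, Real.norm_of_nonneg (by positivity)]
  calc _ ≤ (1 - t) ^ p * ((2 * n + 2 * (p + 1 : ℕ) : ℝ) ^ n * (‖d‖ / ‖r + t • d‖) ^ (p + 1) /
          ‖r + t • d‖ ^ (n + 1)) := by
        gcongr
        exact norm_expansionTerm_le hm d (p + 1) (norm_pos_iff.1 hv)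
    _ = (2 * n + 2 * (p + 1) : ℝ) ^ n * ((1 - t) * (‖d‖ / ‖r + t • d‖)) ^ p * ‖d‖ /
          ‖r + t • d‖ ^ (n + 2) := by
        rw [mul_pow, pow_succ _ p, pow_succ _ (n + 1)]
        push_cast
        field_simp
    _ ≤ _ := by gcongr

theorem expansionTerm_zero (n : ℕ) (m : ℤ) (d v : Space3) :
    expansionTerm n m d 0 v = irregularHarm v n m := by
  simp [expansionTerm]

theorem norm_irregularHarm_add_sub_sum_le {n : ℕ} {m : ℤ} (hm : |m| ≤ (n : ℤ)) {r d : Space3}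
    (hd : ‖d‖ < ‖r‖) (p : ℕ) :
    ‖irregularHarm (r + d) n m - ∑ ν ∈ Finset.range (p + 1), expansionTerm n m d ν r‖ ≤
      (p + 1) * ((2 * n + 2 * (p + 1) : ℝ) ^ n * (‖d‖ / ‖r‖) ^ p * ‖d‖ /
        (‖r‖ - ‖d‖) ^ (n + 2)) := by
  have hne (t : ℝ) (ht : t ∈ Set.Icc (0 : ℝ) 1) : r + t • d ≠ 0 := by
    refine norm_pos_iff.1 (lt_of_lt_of_le ?_ (norm_sub_mul_norm_le_norm_add_smul r d ht.1))
    nlinarith [ht.2, norm_nonneg d]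
  have hderiv (ν : ℕ) (t : ℝ) (ht : t ∈ Set.Icc (0 : ℝ) 1) :
      HasDerivAt (fun t : ℝ => expansionTerm n m d ν (r + t • d))
        ((ν + 1) • expansionTerm n m d (ν + 1) (r + t • d)) t := by
    rw [nsmul_eq_mul]
    exact hasDerivAt_expansionTerm_line hm r d ν t (hne t ht)
  have htaylor := norm_sub_sum_le_of_hasDerivAt hderiv (p := p)
    (C := (p + 1) * ((2 * n + 2 * (p + 1) : ℝ) ^ n * (‖d‖ / ‖r‖) ^ p * ‖d‖ /
      (‖r‖ - ‖d‖) ^ (n + 2))) fun t ht => by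
    rw [RCLike.norm_nsmul ℝ, nsmul_eq_mul, Nat.cast_succ]
    gcongr
    exact norm_taylorRemainder_le hm hd p (Set.Ico_subset_Icc_self ht)
  simpa only [expansionTerm_zero, one_smul, zero_smul, add_zero] using htaylor

theorem hasSum_expansionTerm {n : ℕ} {m : ℤ} (hm : |m| ≤ (n : ℤ)) {r d : Space3}
    (hd : ‖d‖ < ‖r‖) :
    HasSum (fun ν => expansionTerm n m d ν r) (irregularHarm (r + d) n m) := by
  have hr : 0 < ‖r‖ := (norm_nonneg d).trans_lt hd
  have hρ : ‖d‖ / ‖r‖ < 1 := (div_lt_one hr).2 hd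
  have hsummable : Summable fun ν => expansionTerm n m d ν r := by
    refine .of_norm_bounded ((summable_add_pow_mul_geometric n (a := n) (by positivity)
      (by positivity) hρ).mul_left (2 ^ n / ‖r‖ ^ (n + 1))) fun ν =>
        (norm_expansionTerm_le hm d ν (norm_pos_iff.1 hr)).trans_eq ?_
    rw [← mul_add, mul_pow]
    ring
  rw [hsummable.hasSum_iff_tendsto_nat, ← Filter.tendsto_add_atTop_iff_nat 1,
    tendsto_iff_norm_sub_tendsto_zero]
  have hbound := ((summable_add_pow_mul_geometric (n + 1) (a := n + 1) (by positivity)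
    (by positivity) hρ).mul_left (2 ^ n * ‖d‖ / (‖r‖ - ‖d‖) ^ (n + 2))).tendsto_atTop_zero
  refine squeeze_zero (fun _ => norm_nonneg _) (fun p => ?_) hbound
  rw [norm_sub_rev]
  refine (norm_irregularHarm_add_sub_sum_le hm hd p).trans ?_
  have : 0 < ‖r‖ - ‖d‖ := sub_pos.2 hd
  calc _ = 2 ^ n * ‖d‖ / (‖r‖ - ‖d‖) ^ (n + 2) *
          ((p + 1) * (n + 1 + p : ℝ) ^ n * (‖d‖ / ‖r‖) ^ p) := by
        rw [← mul_add, mul_pow]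
        ring
    _ ≤ _ := by
        have hle : (p + 1 : ℝ) ≤ n + 1 + p := by linarith [n.cast_nonneg (α := ℝ)]
        rw [pow_succ' _ n]
        gcongr

/-! ### Comparison with spherical harmonics -/

/-- The symbol of `ladder v`, multiplied by `T` to make it a polynomial. -/
def ladderSymbol (v : Space3) : ℂ[X] :=
  C (conj (planar v) / 2) + C (v 2 : ℂ) * X + C (-(planar v / 2)) * X ^ 2

theorem coeff_ladderSymbol_pow (v : Space3) (n j : ℕ) :
    (ladderSymbol v ^ n).coeff j = regularHarm v n (j - n) := by
  induction n generalizing j with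
  | zero => simp [coeff_one, Pi.single_apply]
  | succ n ih =>
    have hmul (p : ℂ[X]) : p * ladderSymbol v = C (conj (planar v) / 2) * p
        + C (v 2 : ℂ) * (p * X) + C (-(planar v / 2)) * (p * X ^ 2) := by
      rw [ladderSymbol]
      ring
    have hX : (ladderSymbol v ^ n * X).coeff j = regularHarm v n (j - 1 - n) := by
      rcases j with _ | j
      · rw [coeff_mul_X_zero, regularHarm_eq_zero v (by grind)]
      · rw [coeff_mul_X, ih, Nat.cast_succ, add_sub_cancel_right]
    have hX2 : (ladderSymbol v ^ n * X ^ 2).coeff j = regularHarm v n (j - 2 - n) := by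
      rw [coeff_mul_X_pow']
      split_ifs with hj
      · rw [ih, Nat.cast_sub hj, Nat.cast_two]
      · rw [regularHarm_eq_zero v (by grind)]
    rw [pow_succ, hmul, coeff_add, coeff_add, coeff_C_mul, coeff_C_mul, coeff_C_mul, hX, hX2, ih,
      regularHarm_succ_apply, Nat.cast_succ, show (j : ℤ) - (n + 1) + 1 = j - n by ring,
      show (j : ℤ) - (n + 1) - 1 = j - 2 - n by ring, show (j : ℤ) - (n + 1) = j - 1 - n by ring]
    ring

theorem coeff_trinomial_pow_add {R : Type*} [CommRing R] [IsDomain R] (a b c : R) (n k : ℕ) :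
    ((C a + C b * X + C c * X ^ 2) ^ n).coeff (n + k) =
      c ^ k * ((C (a * c) + C b * X + X ^ 2) ^ n).coeff (n + k) := by
  rcases eq_or_ne c 0 with rfl | hc
  · rcases k with _ | k
    · have hdeg := coeff_pow_of_natDegree_le (m := n) (natDegree_linear_le (a := b) (b := a))
      have hfactor : C (a * 0) + C b * X + X ^ 2 = (X + C b) * X := by
        rw [mul_zero, C_0]
        ring
      rw [C_0, zero_mul, add_zero, hfactor, mul_pow, add_zero, coeff_mul_X_pow', if_pos le_rfl,
        Nat.sub_self, add_comm (C a)]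
      simpa [coeff_zero_eq_eval_zero] using hdeg
    · rw [zero_pow k.succ_ne_zero, zero_mul, C_0, zero_mul, add_zero]
      refine coeff_eq_zero_of_natDegree_lt ((natDegree_pow_le_of_le n ?_).trans_lt
        (by omega : n * 1 < _))
      rw [add_comm]
      exact natDegree_linear_le
  · have hcomp : (C (a * c) + C b * X + X ^ 2).comp (C c * X) =
        C c * (C a + C b * X + C c * X ^ 2) := by
      simp only [add_comp, mul_comp, pow_comp, C_comp, X_comp, C_mul]
      ring
    have hcoeff := comp_C_mul_X_coeff (p := (C (a * c) + C b * X + X ^ 2) ^ n) (r := c)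
      (n := n + k)
    rw [pow_comp, hcomp, mul_pow, ← C_pow, coeff_C_mul, pow_add] at hcoeff
    refine mul_left_cancel₀ (pow_ne_zero n hc) (hcoeff.trans ?_)
    ring

theorem eval_iterate_derivative_legendrePoly (n k : ℕ) (x : ℝ) :
    (derivative^[k] (legendrePoly n)).eval x = (n + k).factorial / (2 ^ n * n.factorial) *
      ((C (x ^ 2 - 1) + C (2 * x) * X + X ^ 2) ^ n).coeff (n + k) := by
  have htaylor : taylor x ((X ^ 2 - 1) ^ n) = (C (x ^ 2 - 1) + C (2 * x) * X + X ^ 2) ^ n := by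
    rw [taylor_pow, map_sub, taylor_pow, taylor_X, taylor_one]
    simp only [C_sub, C_mul, C_pow, C_1, C_ofNat]
    ring
  rw [← htaylor, taylor_coeff, legendrePoly, iterate_derivative_C_mul, eval_C_mul,
    ← Function.iterate_add_apply, add_comm k n, ← factorial_smul_hasseDeriv, LinearMap.smul_apply,
    eval_smul, nsmul_eq_mul]
  ring

theorem coeff_trinomial_pow_scale {R : Type*} [CommRing R] (s x : R) (n j : ℕ) :
    s ^ j * ((C (s ^ 2 * (x ^ 2 - 1)) + C (s * (2 * x)) * X + X ^ 2) ^ n).coeff j =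
      (s ^ 2) ^ n * ((C (x ^ 2 - 1) + C (2 * x) * X + X ^ 2) ^ n).coeff j := by
  have hcomp : (C (s ^ 2 * (x ^ 2 - 1)) + C (s * (2 * x)) * X + X ^ 2).comp (C s * X) =
      C (s ^ 2) * (C (x ^ 2 - 1) + C (2 * x) * X + X ^ 2) := by
    simp only [add_comp, mul_comp, pow_comp, C_comp, X_comp, C_mul, C_pow]
    ring
  rw [mul_comm, ← comp_C_mul_X_coeff, pow_comp, hcomp, mul_pow, ← C_pow, coeff_C_mul]

/-- Rescaling the variable turns the quadratic `ladderSymbol v` into a multiple of `(x + X) ^ 2 - 1`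
with `x = cos θ`, whose `n`-th power is the Taylor expansion in Rodrigues' formula. -/
theorem regularHarm_natCast_eq_legendre {v : Space3} (hv : v ≠ 0) (n k : ℕ) :
    regularHarm v n k = ‖v‖ ^ n * (-(planar v / ‖v‖)) ^ k * (n.factorial / (n + k).factorial) *
      ((derivative^[k] (legendrePoly n)).eval (v 2 / ‖v‖) : ℝ) := by
  have hv' : (‖v‖ : ℂ) ≠ 0 := by simpa using hv
  have hfact (j : ℕ) : (j.factorial : ℂ) ≠ 0 := by exact_mod_cast j.factorial_ne_zero
  set x : ℝ := v 2 / ‖v‖ with hx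
  have hz : (v 2 : ℂ) = ‖v‖ / 2 * (2 * x) := by
    rw [hx]
    push_cast
    field_simp
  have hprod : conj (planar v) / 2 * -(planar v / 2) = (‖v‖ / 2 : ℂ) ^ 2 * ((x : ℂ) ^ 2 - 1) := by
    have h := normSq_planar_add_sq v
    rw [hz] at h
    linear_combination -h / 4
  have hcast : ((C (x ^ 2 - 1) + C (2 * x) * X + X ^ 2) ^ n).map Complex.ofRealHom =
      (C ((x : ℂ) ^ 2 - 1) + C (2 * (x : ℂ)) * X + X ^ 2) ^ n := by
    simp
  have hsymbol := coeff_ladderSymbol_pow v n (n + k)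
  have hscale := coeff_trinomial_pow_scale (‖v‖ / 2 : ℂ) x n (n + k)
  rw [ladderSymbol, coeff_trinomial_pow_add, hprod, hz, Nat.cast_add, add_sub_cancel_left]
    at hsymbol
  rw [← hcast, coeff_map, ← eq_inv_mul_iff_mul_eq₀ (pow_ne_zero _ (by simpa using hv))] at hscale
  rw [eval_iterate_derivative_legendrePoly, ← hsymbol, hscale]
  have := hfact (n + k)
  have := hfact n
  simp only [Complex.ofRealHom_eq_coe, pow_add, div_pow, neg_div']
  push_cast
  field_simp
  rw [pow_right_comm 2, pow_right_comm (‖v‖ : ℂ)]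
  ring

theorem abs_coord_two_div_norm_le (v : Space3) : |v 2 / ‖v‖| ≤ 1 := by
  rw [abs_div, abs_norm]
  exact div_le_one_of_le₀ (by simpa using PiLp.norm_apply_le v 2) (norm_nonneg v)

theorem cos_polarAngle (v : Space3) : Real.cos (polarAngle v) = v 2 / ‖v‖ :=
  have h := abs_le.1 (abs_coord_two_div_norm_le v)
  Real.cos_arccos h.1 h.2

theorem planar_div_norm_eq {v : Space3} (hv : v ≠ 0) :
    planar v / ‖v‖ = √(1 - (v 2 / ‖v‖) ^ 2) * Complex.exp (Complex.I * azimuth v) := by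
  have hv' : ‖v‖ ≠ 0 := norm_ne_zero_iff.2 hv
  have hsq : ‖planar v‖ ^ 2 + v 2 ^ 2 = ‖v‖ ^ 2 := by
    have h := normSq_planar_add_sq v
    rw [Complex.mul_conj'] at h
    exact_mod_cast h
  have hsqrt : √(1 - (v 2 / ‖v‖) ^ 2) = ‖planar v‖ / ‖v‖ := by
    rw [Real.sqrt_eq_iff_eq_sq (sub_nonneg.2 ((sq_le_one_iff_abs_le_one _).2
      (abs_coord_two_div_norm_le v))) (by positivity)]
    field_simp
    linarith
  have hpolar : ‖planar v‖ * Complex.exp (Complex.I * azimuth v) = planar v := by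
    rw [mul_comm Complex.I]
    exact Complex.norm_mul_exp_arg_mul_I (planar v)
  rw [hsqrt, Complex.ofReal_div, div_mul_eq_mul_div, hpolar]

theorem regularHarm_natCast_eq_assocLegendre {v : Space3} (hv : v ≠ 0) (n k : ℕ) :
    regularHarm v n k = ‖v‖ ^ n * (n.factorial / (n + k).factorial) *
      (assocLegendreNonneg n k (Real.cos (polarAngle v)) *
        Complex.exp (Complex.I * k * azimuth v)) := by
  have hexp : Complex.exp (Complex.I * k * azimuth v) =
      Complex.exp (Complex.I * azimuth v) ^ k := by
    rw [← Complex.exp_nat_mul]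
    ring_nf
  rw [regularHarm_natCast_eq_legendre hv, planar_div_norm_eq hv, cos_polarAngle,
    assocLegendreNonneg, hexp, neg_pow, mul_pow]
  push_cast
  ring

theorem sqrt_factorial_ratio_eq {n k : ℕ} (c : ℝ) :
    √(c * ((n.factorial : ℝ) / k.factorial)) =
      √(c / (n.factorial * k.factorial)) * n.factorial := by
  have hn : 0 < (n.factorial : ℝ) := by positivity
  rw [← Real.sqrt_mul_self hn.le, ← Real.sqrt_mul' _ (by positivity), Real.sqrt_mul_self hn.le]
  congr 1
  field_simp

/-- The constant relating the normalised solid harmonics to `regularHarm` and `irregularHarm`. -/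
def solidNormalization (n : ℕ) (m : ℤ) : ℝ := √((2 * n + 1) / (4 * Real.pi) / factorialProd n m)

theorem sphericalHarmonic_eq_solidNormalization_mul (n : ℕ) (m : ℤ) (θ φ : ℝ) :
    sphericalHarmonic n m θ φ = solidNormalization n m * (((n : ℤ) - m).toNat.factorial *
      (assocLegendre n m (Real.cos θ) * Complex.exp (Complex.I * m * φ))) := by
  rw [sphericalHarmonic, solidNormalization, factorialProd, sqrt_factorial_ratio_eq]
  push_cast
  ring

theorem solidNormalization_neg (n : ℕ) (m : ℤ) :
    solidNormalization n (-m) = solidNormalization n m := by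
  rw [solidNormalization, factorialProd_neg, solidNormalization]

theorem sphericalHarmonic_neg {n k : ℕ} (hk : k ≤ n) (θ φ : ℝ) :
    sphericalHarmonic n (-k) θ φ = (-1) ^ k * conj (sphericalHarmonic n k θ φ) := by
  rcases k with _ | k
  · simp [sphericalHarmonic, Complex.conj_ofReal]
  have hfact : ((n + (k + 1)).factorial : ℂ) ≠ 0 := by exact_mod_cast Nat.factorial_ne_zero _
  have hexp : Complex.exp (Complex.I * (-(k + 1 : ℕ) : ℤ) * φ) =
      conj (Complex.exp (Complex.I * (k + 1 : ℕ) * φ)) := by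
    rw [← Complex.exp_conj]
    congr 1
    simp only [map_mul, Complex.conj_I, map_natCast, Complex.conj_ofReal]
    push_cast
    ring
  rw [sphericalHarmonic_eq_solidNormalization_mul, sphericalHarmonic_eq_solidNormalization_mul,
    solidNormalization_neg, hexp, assocLegendre, if_neg (by omega), assocLegendre,
    if_pos (by omega), Int.natAbs_neg, Int.natAbs_natCast,
    show ((n : ℤ) - -(k + 1 : ℕ)).toNat = n + (k + 1) by omega,
    show ((n : ℤ) - (k + 1 : ℕ)).toNat = n - (k + 1) by omega]
  simp only [map_mul, Complex.conj_ofReal, map_natCast, Int.cast_natCast]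
  push_cast
  field_simp

theorem sphericalHarmonicDir_eq {n : ℕ} {m : ℤ} (hm : |m| ≤ (n : ℤ)) {v : Space3} (hv : v ≠ 0) :
    sphericalHarmonicDir n m v = solidNormalization n m * factorialProd n m / n.factorial *
      regularHarm v n m / ‖v‖ ^ n := by
  have hv' : (‖v‖ : ℂ) ≠ 0 := by simpa using hv
  have hnonneg (k : ℕ) (hk : k ≤ n) : sphericalHarmonicDir n k v =
      solidNormalization n k * factorialProd n k / n.factorial * regularHarm v n k / ‖v‖ ^ n := by
    have hfact (j : ℕ) : (j.factorial : ℂ) ≠ 0 := by exact_mod_cast j.factorial_ne_zero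
    have := hfact n
    have := hfact (n + k)
    rw [sphericalHarmonicDir, sphericalHarmonic_eq_solidNormalization_mul,
      regularHarm_natCast_eq_assocLegendre hv, assocLegendre, if_pos (by omega), factorialProd,
      Int.natAbs_natCast, show ((n : ℤ) + k).toNat = n + k by omega]
    push_cast
    field_simp
  obtain ⟨k, rfl | rfl⟩ := m.eq_nat_or_neg
  · exact hnonneg k (by simpa using hm)
  · have hk : k ≤ n := by simpa using hm
    rw [sphericalHarmonicDir, sphericalHarmonic_neg hk, ← sphericalHarmonicDir, hnonneg k hk,
      regularHarm_neg, solidNormalization_neg, factorialProd_neg]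
    simp only [map_mul, map_div₀, map_pow, Complex.conj_ofReal, map_natCast, zpow_natCast]
    ring

theorem regularSolid_eq {n : ℕ} {m : ℤ} (hm : |m| ≤ (n : ℤ)) (v : Space3) :
    regularSolid n m v =
      solidNormalization n m * factorialProd n m / n.factorial * regularHarm v n m := by
  rcases eq_or_ne v 0 with rfl | hv
  · rcases n with _ | n
    · obtain rfl : m = 0 := by simpa using hm
      simp [regularSolid, sphericalHarmonicDir, sphericalHarmonic, assocLegendre,
        assocLegendreNonneg, legendrePoly, solidNormalization, factorialProd]
    · have hplanar : planar 0 = 0 := by simp [planar, Complex.ext_iff]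
      simp [regularSolid, regularHarm_succ_apply, hplanar]
  · have hv' : (‖v‖ : ℂ) ≠ 0 := by simpa using hv
    rw [regularSolid, sphericalHarmonicDir_eq hm hv]
    push_cast
    field_simp

theorem irregularSolid_eq {n : ℕ} {m : ℤ} (hm : |m| ≤ (n : ℤ)) {v : Space3} (hv : v ≠ 0) :
    irregularSolid n m v =
      (-1) ^ ((n : ℤ) + m) * solidNormalization n m * irregularHarm v n m := by
  have hv' : (‖v‖ : ℂ) ≠ 0 := by simpa using hv
  have hsign : (-1 : ℂ) ^ ((n : ℤ) + m) * (-1) ^ ((n : ℤ) + m) = 1 := by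
    rw [← mul_zpow]
    norm_num
  calc irregularSolid n m v
      = solidNormalization n m * factorialProd n m / n.factorial * regularHarm v n m /
          ‖v‖ ^ (2 * n + 1) := by
        rw [irregularSolid, sphericalHarmonicDir_eq hm hv]
        push_cast
        field_simp
        ring
    _ = _ := by
        rw [irregularHarm, irregularNumerator]
        linear_combination -(solidNormalization n m * factorialProd n m / n.factorial *
          regularHarm v n m / ‖v‖ ^ (2 * n + 1) : ℂ) * hsign

theorem translationCoeff_mul_solidNormalization {n ν : ℕ} {m μ : ℤ} (hm : |m| ≤ (n : ℤ))
    (hμ : |μ| ≤ (ν : ℤ)) :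
    2 * √Real.pi * (translationCoeff n m ν μ / √(2 * (ν : ℝ) + 1) *
      (solidNormalization ν μ * factorialProd ν μ) * solidNormalization (n + ν) (m - μ)) =
    solidNormalization n m := by
  rw [abs_le] at hm hμ
  have htwo_sqrt : 2 * √Real.pi = √(4 * Real.pi) := by
    rw [show (4 : ℝ) = 2 ^ 2 by norm_num, Real.sqrt_mul (by positivity), Real.sqrt_sq (by norm_num)]
  have hnormalization : solidNormalization ν μ * factorialProd ν μ =
      √((2 * ν + 1) / (4 * Real.pi) * factorialProd ν μ) := by
    have hpos := factorialProd_pos ν μ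
    rw [solidNormalization, ← Real.sqrt_mul_self hpos.le, ← Real.sqrt_mul' _ (by positivity),
      Real.sqrt_mul_self hpos.le]
    congr 1
    field_simp
  have hlow : ((n : ℤ) + m + ν - μ).toNat = ((ν : ℤ) - μ).toNat + ((n : ℤ) + m).toNat := by omega
  have hhigh : ((n : ℤ) - m + ν + μ).toNat = ((ν : ℤ) + μ).toNat + ((n : ℤ) - m).toNat := by omega
  have hhigh' : (((n + ν : ℕ) : ℤ) - (m - μ)).toNat =
      ((ν : ℤ) + μ).toNat + ((n : ℤ) - m).toNat := by omega
  have hlow' : (((n + ν : ℕ) : ℤ) + (m - μ)).toNat =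
      ((ν : ℤ) - μ).toNat + ((n : ℤ) + m).toNat := by omega
  rw [hnormalization, htwo_sqrt, translationCoeff, solidNormalization, solidNormalization,
    factorialProd, factorialProd, factorialProd, hlow, hhigh, hlow', hhigh', Nat.cast_add_choose,
    Nat.cast_add_choose, ← Real.sqrt_div' _ (by positivity), ← Real.sqrt_mul (by positivity),
    ← Real.sqrt_mul (by positivity), ← Real.sqrt_mul (by positivity)]
  congr 1
  push_cast
  field_simp

theorem translationTerm_eq {n : ℕ} {m : ℤ} (hm : |m| ≤ (n : ℤ)) {r : Space3} (hr : r ≠ 0)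
    (d : Space3) (ν : ℕ) :
    translationTerm n m r d ν =
      (-1) ^ ((n : ℤ) + m) * solidNormalization n m * expansionTerm n m d ν r := by
  rw [translationTerm, expansionTerm, mul_div_assoc', Finset.mul_sum, Finset.mul_sum,
    Finset.sum_div]
  refine Finset.sum_congr rfl fun μ hμ => ?_
  have hμ' := abs_le.2 (Finset.mem_Icc.1 hμ)
  have hsign : (-1 : ℂ) ^ ((ν : ℤ) + μ) * (-1) ^ (((n + ν : ℕ) : ℤ) + (m - μ)) =
      (-1) ^ ((n : ℤ) + m) := by
    rw [← zpow_add₀ (by norm_num), show (ν : ℤ) + μ + ((n + ν : ℕ) + (m - μ)) =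
      n + m + 2 * ν by push_cast; ring, zpow_add₀ (by norm_num), zpow_mul]
    simp
  rw [regularSolid_eq hμ', irregularSolid_eq (by grind) hr,
    ← translationCoeff_mul_solidNormalization hm hμ', ← hsign]
  push_cast
  ring

theorem hasSum_translationTerm {n : ℕ} {m : ℤ} (hm : |m| ≤ (n : ℤ)) {r d : Space3}
    (hd : ‖d‖ < ‖r‖) :
    HasSum (translationTerm n m r d) (irregularSolid n m (r + d)) := by
  have hr : r ≠ 0 := norm_pos_iff.1 ((norm_nonneg d).trans_lt hd)
  have hrd : r + d ≠ 0 := fun h => hd.ne' (by rw [eq_neg_of_add_eq_zero_left h, norm_neg])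
  rw [irregularSolid_eq hm hrd, funext (translationTerm_eq hm hr d)]
  exact (hasSum_expansionTerm hm hd).mul_left _

/-! ### The truncation error -/

theorem solidNormalization_le (n : ℕ) (m : ℤ) : solidNormalization n m ≤ 2 * n + 1 := by
  have hfact : 1 ≤ factorialProd n m := by
    rw [factorialProd]
    exact_mod_cast Nat.mul_pos (Nat.factorial_pos _) (Nat.factorial_pos _)
  have hpi : 1 ≤ 4 * Real.pi := by linarith [Real.pi_gt_three]
  refine Real.sqrt_le_iff.2 ⟨by positivity, ?_⟩
  calc (2 * n + 1 : ℝ) / (4 * Real.pi) / factorialProd n m ≤ 2 * n + 1 :=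
        (div_le_self (by positivity) hfact).trans (div_le_self (by positivity) hpi)
    _ ≤ (2 * n + 1 : ℝ) ^ 2 := le_self_pow₀ (by linarith [Nat.cast_nonneg (α := ℝ) n]) two_ne_zero

theorem norm_translationTerm_le {n : ℕ} {m : ℤ} (hm : |m| ≤ (n : ℤ)) {r : Space3} (hr : r ≠ 0)
    (d : Space3) (ν : ℕ) : ‖translationTerm n m r d ν‖ ≤
      (2 * n + 1) * 2 ^ n * ((n + ν) ^ n * (‖d‖ / ‖r‖) ^ ν) / ‖r‖ ^ (n + 1) := by
  have hsign : ‖(-1 : ℂ) ^ ((n : ℤ) + m)‖ = 1 := by simp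
  rw [translationTerm_eq hm hr, norm_mul, norm_mul, hsign, one_mul, Complex.norm_real,
    Real.norm_of_nonneg (show 0 ≤ solidNormalization n m from Real.sqrt_nonneg _)]
  calc _ ≤ (2 * n + 1) * ((2 * n + 2 * ν) ^ n * (‖d‖ / ‖r‖) ^ ν / ‖r‖ ^ (n + 1)) := by
        gcongr
        · exact solidNormalization_le n m
        · exact norm_expansionTerm_le hm d ν hr
    _ = _ := by
        rw [← mul_add, mul_pow]
        ring

theorem truncationError_le {n : ℕ} {m : ℤ} (hm : |m| ≤ (n : ℤ)) {r d : Space3} (hr : r ≠ 0)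
    (hd : ‖d‖ / ‖r‖ < 1) (p : ℕ) :
    truncationError n m r d p ≤ (2 * n + 1) * 4 ^ n *
      ((n + p + 1) ^ n + n.factorial * (1 / (1 - ‖d‖ / ‖r‖)) ^ n) *
      ((‖d‖ / ‖r‖) ^ (p + 1) / ((1 - ‖d‖ / ‖r‖) * ‖r‖ ^ (n + 1))) := by
  set ρ := ‖d‖ / ‖r‖ with hρ
  have hρ0 : 0 ≤ ρ := by positivity
  have ha : (0 : ℝ) ≤ n + p + 1 := by positivity
  have hterm (k : ℕ) : ‖translationTerm n m r d (p + 1 + k)‖ ≤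
      ((2 * n + 1) * 2 ^ n * ρ ^ (p + 1) / ‖r‖ ^ (n + 1)) * ((n + p + 1 + k) ^ n * ρ ^ k) := by
    refine (norm_translationTerm_le hm hr d (p + 1 + k)).trans_eq ?_
    rw [← hρ]
    push_cast
    ring
  calc truncationError n m r d p
      ≤ ((2 * n + 1) * 2 ^ n * ρ ^ (p + 1) / ‖r‖ ^ (n + 1)) *
          ∑' k : ℕ, (n + p + 1 + k : ℝ) ^ n * ρ ^ k :=
        tsum_of_norm_bounded ((summable_add_pow_mul_geometric n ha hρ0 hd).hasSum.mul_left _) hterm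
    _ ≤ ((2 * n + 1) * 2 ^ n * ρ ^ (p + 1) / ‖r‖ ^ (n + 1)) *
          (2 ^ n * ((n + p + 1) ^ n + n.factorial * (1 / (1 - ρ)) ^ n) / (1 - ρ)) := by
        gcongr
        exact tsum_add_pow_mul_geometric_le n ha hρ0 hd
    _ = _ := by
        rw [show (4 : ℝ) = 2 * 2 by norm_num, mul_pow, div_mul_eq_div_div_swap]
        ring

theorem one_le_mul_truncationThreshold (n : ℕ) {δ : ℝ} (hδ : 0 < δ) :
    1 ≤ δ * truncationThreshold n δ := by
  rw [truncationThreshold, mul_div_cancel₀ _ hδ.ne']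
  linarith [Nat.cast_nonneg (α := ℝ) n]

theorem add_one_le_truncationThreshold (n : ℕ) {δ : ℝ} (hδ : 0 < δ) (hδ1 : δ ≤ 1) :
    (n + 1 : ℝ) ≤ truncationThreshold n δ :=
  le_div_self (by positivity) hδ hδ1

theorem exp_mul_div_two_le_one_add_rpow {δ x : ℝ} (hδ : 0 ≤ δ) (hδ1 : δ ≤ 1) (hx : 0 ≤ x) :
    Real.exp (δ * x / 2) ≤ (1 + δ) ^ x := by
  have hlog : δ / 2 ≤ Real.log (1 + δ) := by
    refine le_trans ?_ (Real.le_log_one_add_of_nonneg hδ)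
    rw [div_le_div_iff₀ two_pos (by linarith)]
    nlinarith
  rw [Real.rpow_def_of_pos (by linarith), Real.exp_le_exp, mul_div_right_comm]
  gcongr

theorem add_pow_le_mul_one_add_rpow (n : ℕ) {δ N x : ℝ} (hδ : 0 ≤ δ) (hδ1 : δ ≤ 1) (hN : 0 ≤ N)
    (hδN : 1 ≤ δ * N) (hx : 0 ≤ x) :
    (N + x) ^ n ≤ 2 ^ n * n.factorial * Real.exp 1 * N ^ n * (1 + δ) ^ x := by
  have hlinear : N + x ≤ N * (2 * (1 + δ * x / 2)) := by nlinarith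
  have hpow : (1 + δ * x / 2) ^ n ≤ n.factorial * (Real.exp 1 * (1 + δ) ^ x) := by
    have h := Real.pow_div_factorial_le_exp (x := 1 + δ * x / 2) (by positivity) n
    rw [div_le_iff₀' (by positivity), Real.exp_add] at h
    exact h.trans (by gcongr; exact exp_mul_div_two_le_one_add_rpow hδ hδ1 hx)
  calc (N + x) ^ n ≤ (N * (2 * (1 + δ * x / 2))) ^ n := by gcongr
    _ = 2 ^ n * N ^ n * (1 + δ * x / 2) ^ n := by
        rw [mul_pow, mul_pow]
        ring
    _ ≤ 2 ^ n * N ^ n * (n.factorial * (Real.exp 1 * (1 + δ) ^ x)) := by gcongr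
    _ = _ := by ring

/-- The constant in the truncation bound `truncationError_le_truncationConst_mul`; the parameter `D`
measures how close `ρ` may be to `1`, through `1 / (1 - ρ) ≤ D (p + 1)`. -/
def truncationConst (n : ℕ) (D : ℝ) : ℝ :=
  (2 * n + 1) * 4 ^ n * (2 ^ n + n.factorial * D ^ n) * (2 ^ n * n.factorial * Real.exp 1)

theorem truncationError_le_truncationConst_mul {n : ℕ} {m : ℤ} (hm : |m| ≤ (n : ℤ))
    {r d : Space3} (hr : r ≠ 0) (hd : ‖d‖ / ‖r‖ < 1) {δ : ℝ} (hδ : 0 < δ) (hδ1 : δ ≤ 1) {p : ℕ}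
    (hp : truncationThreshold n δ ≤ p) {D : ℝ} (hD : 0 ≤ D)
    (hinv : 1 / (1 - ‖d‖ / ‖r‖) ≤ D * (p + 1)) :
    truncationError n m r d p ≤ truncationConst n D * truncationThreshold n δ ^ n *
      ((1 + δ) ^ ((p : ℝ) + 1 - truncationThreshold n δ) * (‖d‖ / ‖r‖) ^ (p + 1) /
        ((1 - ‖d‖ / ‖r‖) * ‖r‖ ^ (n + 1))) := by
  have hN := add_one_le_truncationThreshold n hδ hδ1
  have : 0 < 1 - ‖d‖ / ‖r‖ := by linarith
  set N := truncationThreshold n δ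
  have hfirst : (n + p + 1 : ℝ) ^ n ≤ 2 ^ n * (p + 1) ^ n := by
    rw [← mul_pow]
    gcongr
    linarith
  have hsecond : (1 / (1 - ‖d‖ / ‖r‖)) ^ n ≤ D ^ n * (p + 1) ^ n := by
    rw [← mul_pow]
    gcongr
  have hgrowth : (p + 1 : ℝ) ^ n ≤
      2 ^ n * n.factorial * Real.exp 1 * N ^ n * (1 + δ) ^ ((p : ℝ) + 1 - N) := by
    have h := add_pow_le_mul_one_add_rpow n hδ.le hδ1 (by linarith [Nat.cast_nonneg (α := ℝ) n])
      (one_le_mul_truncationThreshold n hδ) (by linarith : 0 ≤ (p : ℝ) + 1 - N)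
    rwa [add_sub_cancel] at h
  calc truncationError n m r d p
      ≤ (2 * n + 1) * 4 ^ n *
          (2 ^ n * (p + 1) ^ n + n.factorial * (D ^ n * (p + 1) ^ n)) *
          ((‖d‖ / ‖r‖) ^ (p + 1) / ((1 - ‖d‖ / ‖r‖) * ‖r‖ ^ (n + 1))) :=
        (truncationError_le hm hr hd p).trans (by gcongr)
    _ = (2 * n + 1) * 4 ^ n * (2 ^ n + n.factorial * D ^ n) * (p + 1) ^ n *
          ((‖d‖ / ‖r‖) ^ (p + 1) / ((1 - ‖d‖ / ‖r‖) * ‖r‖ ^ (n + 1))) := by ring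
    _ ≤ (2 * n + 1) * 4 ^ n * (2 ^ n + n.factorial * D ^ n) *
          (2 ^ n * n.factorial * Real.exp 1 * N ^ n * (1 + δ) ^ ((p : ℝ) + 1 - N)) *
          ((‖d‖ / ‖r‖) ^ (p + 1) / ((1 - ‖d‖ / ‖r‖) * ‖r‖ ^ (n + 1))) := by gcongr
    _ = _ := by
        rw [truncationConst]
        ring

/-- A large multiple of `X ^ (2 n)` gives the bound; adding `X ^ (2 n + 2)` makes `q` monic and the
inequality strict. -/
theorem exists_monic_natDegree_mul_pow_lt_sqrt (n : ℕ) {B c : ℝ} (hc : 0 < c) :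
    ∃ q : ℝ[X], q.Monic ∧ q.natDegree = 2 * n + 2 ∧
      ∀ N : ℝ, 0 < N → B * N ^ n < √(3 * q.eval (2 * N) / c) := by
  refine ⟨X ^ (2 * n + 2) + C (B ^ 2 * c / 3) * X ^ (2 * n), by monicity!, by compute_degree!,
    fun N hN => Real.lt_sqrt_of_sq_lt ?_⟩
  simp only [eval_add, eval_mul, eval_pow, eval_X, eval_C]
  rw [lt_div_iff₀ hc]
  calc (B * N ^ n) ^ 2 * c = 3 * (B ^ 2 * c / 3 * N ^ (2 * n)) := by ring
    _ ≤ 3 * (B ^ 2 * c / 3 * (2 * N) ^ (2 * n)) := by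
        gcongr
        linarith
    _ < 3 * ((2 * N) ^ (2 * n + 2) + B ^ 2 * c / 3 * (2 * N) ^ (2 * n)) := by
        gcongr
        exact lt_add_of_pos_left _ (by positivity)

theorem exists_monic_truncationBound (n : ℕ) {D : ℝ} (hD : 0 ≤ D) :
    ∃ q : ℝ[X], q.Monic ∧ q.natDegree = 2 * n + 2 ∧
      ∀ (δ : ℝ) (m : ℤ) (r d : Space3), 0 < δ → δ ≤ 1 → |m| ≤ (n : ℤ) → r ≠ 0 → d ≠ 0 →
        ‖d‖ / ‖r‖ < 1 → ∀ p : ℕ, truncationThreshold n δ ≤ (p : ℝ) →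
          1 / (1 - ‖d‖ / ‖r‖) ≤ D * (p + 1) →
          truncationError n m r d p < truncationBound n q δ (‖d‖ / ‖r‖) ‖r‖ p := by
  obtain ⟨q, hmonic, hdeg, hq⟩ := exists_monic_natDegree_mul_pow_lt_sqrt n
    (B := truncationConst n D) (by positivity : 0 < 4 * Real.pi * (2 * n).factorial)
  refine ⟨q, hmonic, hdeg, fun δ m r d hδ hδ1 hm hr hd hρ p hp hinv => ?_⟩
  have : 0 < ‖r‖ := norm_pos_iff.2 hr
  have : 0 < ‖d‖ := norm_pos_iff.2 hd
  have hN : 0 < truncationThreshold n δ := div_pos (by positivity) hδ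
  have : 0 < 1 - ‖d‖ / ‖r‖ := by linarith
  refine (truncationError_le_truncationConst_mul hm hr hρ hδ hδ1 hp hD hinv).trans_lt ?_
  rw [truncationBound]
  gcongr
  exact hq _ hN

theorem one_div_one_sub_le_of_one_add_mul_lt_one {δ ρ p : ℝ} (hδ : 0 < δ) (hδ1 : δ ≤ 1)
    (hρ : (1 + δ) * ρ < 1) (hp : 1 ≤ δ * p) : 1 / (1 - ρ) ≤ 2 * (p + 1) := by
  have hgap : δ / 2 ≤ 1 - ρ := by nlinarith
  have hp0 : 0 ≤ p := by nlinarith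
  rw [div_le_iff₀ (by linarith)]
  nlinarith [mul_le_mul_of_nonneg_left hgap hp0]

theorem exists_monic_truncationBound_of_one_add_mul_lt_one (n : ℕ) :
    ∃ q : ℝ[X], q.Monic ∧ q.natDegree = 2 * n + 2 ∧
      ∀ (δ : ℝ) (m : ℤ) (r d : Space3), 0 < δ → δ ≤ 1 → |m| ≤ (n : ℤ) → r ≠ 0 → d ≠ 0 →
        (1 + δ) * (‖d‖ / ‖r‖) < 1 → ∀ p : ℕ, truncationThreshold n δ ≤ (p : ℝ) →
          truncationError n m r d p < truncationBound n q δ (‖d‖ / ‖r‖) ‖r‖ p := by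
  obtain ⟨q, hmonic, hdeg, hq⟩ := exists_monic_truncationBound n zero_le_two
  refine ⟨q, hmonic, hdeg, fun δ m r d hδ hδ1 hm hr hd hρ p hp => ?_⟩
  have hρ1 : ‖d‖ / ‖r‖ < 1 :=
    (le_mul_of_one_le_left (by positivity) (by linarith)).trans_lt hρ
  have hδp : 1 ≤ δ * p := (one_le_mul_truncationThreshold n hδ).trans (by gcongr)
  exact hq δ m r d hδ hδ1 hm hr hd hρ1 p hp
    (one_div_one_sub_le_of_one_add_mul_lt_one hδ hδ1 hρ hδp)

theorem exists_monic_truncationBound_of_le (n : ℕ) {ρ₀ : ℝ} (hρ₀ : ρ₀ < 1) :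
    ∃ q : ℝ[X], q.Monic ∧ q.natDegree = 2 * n + 2 ∧
      ∀ (δ : ℝ) (m : ℤ) (r d : Space3), 0 < δ → δ ≤ 1 → |m| ≤ (n : ℤ) → r ≠ 0 → d ≠ 0 →
        ‖d‖ / ‖r‖ ≤ ρ₀ → ∀ p : ℕ, truncationThreshold n δ ≤ (p : ℝ) →
          truncationError n m r d p < truncationBound n q δ (‖d‖ / ‖r‖) ‖r‖ p := by
  have hD : 0 ≤ 1 / (1 - ρ₀) := one_div_nonneg.2 (by linarith)
  obtain ⟨q, hmonic, hdeg, hq⟩ := exists_monic_truncationBound n hD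
  refine ⟨q, hmonic, hdeg, fun δ m r d hδ hδ1 hm hr hd hρ p hp => ?_⟩
  refine hq δ m r d hδ hδ1 hm hr hd (hρ.trans_lt hρ₀) p hp ?_
  calc 1 / (1 - ‖d‖ / ‖r‖) ≤ 1 / (1 - ρ₀) :=
        one_div_le_one_div_of_le (by linarith) (by linarith)
    _ ≤ 1 / (1 - ρ₀) * (p + 1) :=
        le_mul_of_one_le_right hD (le_add_of_nonneg_left p.cast_nonneg)

end

theorem mainTheorem3 (n : ℕ) :
    -- the expansion
    (∀ (m : ℤ) (r dr : Space3), |m| ≤ (n : ℤ) → ‖dr‖ / ‖r‖ < 1 → r ≠ 0 →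
      HasSum (fun ν : ℕ => translationTerm n m r dr ν) (irregularSolid n m (r + dr))) ∧
    -- the error bound for `(1 + δ) ρ < 1`, with `q` depending only on `n`
    (∃ q : Polynomial ℝ, q.Monic ∧ q.natDegree = 2 * n + 2 ∧
      ∀ (δ : ℝ) (m : ℤ) (r dr : Space3), 0 < δ → δ ≤ 1 → |m| ≤ (n : ℤ) → r ≠ 0 → dr ≠ 0 →
        (1 + δ) * (‖dr‖ / ‖r‖) < 1 →
        ∀ p : ℕ, truncationThreshold n δ ≤ (p : ℝ) →
          truncationError n m r dr p < truncationBound n q δ (‖dr‖ / ‖r‖) ‖r‖ p) ∧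
    -- the error bound for all `ρ < 1`, with `q` depending only on `n`, `δ` and an upper bound of `ρ`
    (∀ (δ ρ₀ : ℝ), 0 < δ → δ ≤ 1 → ρ₀ < 1 →
      ∃ q : Polynomial ℝ, q.Monic ∧ q.natDegree = 2 * n + 2 ∧
        ∀ (m : ℤ) (r dr : Space3), |m| ≤ (n : ℤ) → r ≠ 0 → dr ≠ 0 → ‖dr‖ / ‖r‖ ≤ ρ₀ →
          ∀ p : ℕ, truncationThreshold n δ ≤ (p : ℝ) →
            truncationError n m r dr p < truncationBound n q δ (‖dr‖ / ‖r‖) ‖r‖ p) := by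
  refine ⟨fun m r dr hm hd hr => ?_, exists_monic_truncationBound_of_one_add_mul_lt_one n, ?_⟩
  · exact hasSum_translationTerm hm ((div_lt_one (norm_pos_iff.2 hr)).1 hd)
  · intro δ ρ₀ hδ hδ1 hρ₀
    obtain ⟨q, hmonic, hdeg, hq⟩ := exists_monic_truncationBound_of_le n hρ₀
    exact ⟨q, hmonic, hdeg, fun m r dr => hq δ m r dr hδ hδ1⟩
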